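/- Theorem 3.2. Setting. Let $\mathcal V$ and $E$ be countable sets, let every edge $e\in E$ have a length $l_e\in(0,\infty)$, an initial vertex $i(e)$ and a final vertex $j(e)$, and let $\mathcal G$ be the metric graph obtained by gluing the intervals $[0,l_e]$ at the vertices, where $0$ and $l_e$ represent $i(e)$ and $j(e)$. Let $d$ be the path distance on $\mathcal G$ (the infimum of the lengths of connecting paths), let $f_e:[0,l_e]\to\mathbb R$ be the restriction to the closed edge $e$ of a function $f:\mathcal G\to\mathbb R$, and write $e\ni x$ if $x$ is an endpoint of $e$, and $y\sim x$ if some edge joins $x$ and $y$. Let $\mu_{\mathcal V}:\mathcal V\to(0,\infty)$ be a vertex measure and let $\omega(x,y)=\omega(y,x)>0$ be a weight on adjacent vertices. Put $$\Delta_{\mathcal V}f(x)=\frac1{\mu_{\mathcal V}(x)}\sum_{y\sim x}\omega(x,y)\,(f(y)-f(x)),\qquad [\mathcal K(f)](x)=\sum_{e\ni x}\frac{df_e(x)}{dn}\qquad(x\in\mathcal V),$$ where $\frac{df_e(x)}{dn}$ is $f_e'(l_e)$ if $j(e)=x$ and $-f_e'(0)$ if $i(e)=x$ (one-sided derivatives).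 Hypotheses on $\mathcal G$. Fix $x_0\in\mathcal V$ and put $B_R=\{x\in\mathcal G: d(x,x_0)<R\}$. Assume that (i) $\mathcal G$ is infinite (i.e. $\mathcal V$ or $E$ is infinite), connected and locally finite; (ii) $i(e)\ne j(e)$ for all $e$; (iii) there are $x_n\in\mathcal V$ with $d(x_n,x_0)\to\infty$; (iv) for every $R>0$, $B_R$ contains only finitely many vertices and meets only finitely many edges; (v) there is a constant $C_0>0$ with $\sum_{y\sim x}\omega(x,y)\le C_0\,\mu_{\mathcal V}(x)$ for all $x\in\mathcal V$; (vi) $j:=\sup_e l_e<\infty$ and $\inf_e l_e>0$. Put $R_0=\max\{2j,1\}$. Potential. Let $\sigma>1$, $\delta>0$, $C>0$, and let $V:\mathcal G\to(0,\infty)$ be a function, measurable on each edge, such that for every $R\ge R_0$, with $\alpha=\delta/R$ and with $\delta$ and $C$ not depending on $R$, $$\sum_{x\in\mathcal V\setminus B_R}\mu_{\mathcal V}(x)\,V(x)^{-\frac1{\sigma-1}}e^{-\alpha d(x,x_0)}\le C R^{\frac{\sigma}{\sigma-1}},\qquad \sum_{e}\int_0^{l_e}V_e(x)^{-\frac1{\sigma-1}}e^{-\alpha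 d(x,x_0)}\,dx\le C R^{\frac{\sigma}{\sigma-1}},$$ where the second sum is over the edges $e$ whose interior is contained in $\mathcal G\setminus B_R$. Solution. Let $u:\mathcal G\to\mathbb R$, of arbitrary sign, be a solution of $\Delta_{\mathcal G}u+V|u|^\sigma\le0$ on $\mathcal G$. This means that $u$ is continuous on $\mathcal G$; that for every edge $e$ one has $u_e\in C^2((0,l_e))\cap C^1([0,l_e])$, $u_e''\in L^\infty((0,l_e))$ and $u_e''+V_e|u_e|^\sigma\le0$ on $(0,l_e)$; and that $\Delta_{\mathcal V}u(x)+V(x)|u(x)|^\sigma\le0$ and $[\mathcal K(u)](x)=0$ for every $x\in\mathcal V$. Assume that $u$ lies in $X_\alpha=L^1_{e^{-\alpha d(\cdot,x_0)}}(\mathcal G)$, that is, $$\sum_{x\in\mathcal V}\mu_{\mathcal V}(x)|u(x)|e^{-\alpha d(x,x_0)}+\sum_{e\in E}\int_0^{l_e}|u_e(x)|e^{-\alpha d(x,x_0)}\,dx<\infty,$$ for $\alpha=\delta/R_1$ with some $R_1\ge R_0$. Conclusion. Then $u\equiv0$ on $\mathcal G$. -/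

import Mathlib

open Set Filter MeasureTheory Topology

noncomputable section

/-- A weighted graph `(Vert, Edge, len)` in which every edge `e` has a finite positive length
`len e`, an initial vertex and a final vertex. The edge `e` is identified with the open interval
`(0, len e)`; parallel edges are allowed. -/
structure MetricGraph (Vert Edge : Type*) where
  init : Edge → Vert
  final : Edge → Vert
  len : Edge → ℝ
  len_pos : ∀ e, 0 < len e

namespace MetricGraph

variable {Vert Edge : Type*}

/-- The points of the metric graph: the vertices and the pairs `(e, t)` with `0 < t < len e`. -/
inductive Point (G : MetricGraph Vert Edge) where
  | vertex (v : Vert) : Point G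
  | inner (e : Edge) (t : ℝ) (ht : t ∈ Ioo 0 (G.len e)) : Point G

/-- `v` is an endpoint of the edge `e`. -/
def Incident (G : MetricGraph Vert Edge) (e : Edge) (v : Vert) : Prop :=
  G.init e = v ∨ G.final e = v

/-- `x` and `y` are joined by an edge. -/
def Adj (G : MetricGraph Vert Edge) (x y : Vert) : Prop :=
  ∃ e, (G.init e = x ∧ G.final e = y) ∨ (G.init e = y ∧ G.final e = x)

open Classical in
/-- The point of the closed edge `e` with coordinate `t ∈ [0, len e]`; the coordinates `0` and
`len e` give the initial and the final vertex. Only `t ∈ [0, len e]` is meaningful. -/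
def pt (G : MetricGraph Vert Edge) (e : Edge) (t : ℝ) : G.Point :=
  if h : t ∈ Ioo 0 (G.len e) then Point.inner e t h
  else if t ≤ 0 then Point.vertex (G.init e) else Point.vertex (G.final e)

/-- The restriction `f_e` of a function on the metric graph to the closed edge `e`, as a function
of the coordinate `t ∈ [0, len e]`. Since `f` is a function on points, the values of the `f_e`
at a common vertex agree. -/
def onEdge (G : MetricGraph Vert Edge) (f : G.Point → ℝ) (e : Edge) (t : ℝ) : ℝ :=
  f (G.pt e t)

/-- `G.PathOfLength y x L`: there are points `x = x₁, …, xₙ = y` such that consecutive ones lie on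
a common closed edge, and the lengths of the segments so travelled add up to `L`. -/
inductive PathOfLength (G : MetricGraph Vert Edge) (y : G.Point) : G.Point → ℝ → Prop
  | nil : PathOfLength G y y 0
  | cons {L : ℝ} (e : Edge) (s t : ℝ) (hs : s ∈ Icc 0 (G.len e)) (ht : t ∈ Icc 0 (G.len e))
      (h : PathOfLength G y (G.pt e s) L) : PathOfLength G y (G.pt e t) (L + |t - s|)

/-- The path distance: the infimum of the lengths of the paths from `x` to `y`
(used on connected graphs only). -/
def dist (G : MetricGraph Vert Edge) (x y : G.Point) : ℝ :=
  sInf {L | G.PathOfLength y x L}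

/-- The open ball of radius `R` about `x`. -/
def ball (G : MetricGraph Vert Edge) (x : G.Point) (R : ℝ) : Set G.Point :=
  {y | G.dist y x < R}

/-- Any two vertices are joined by a path. -/
def Connected (G : MetricGraph Vert Edge) : Prop :=
  ∀ v w : Vert, ∃ L, G.PathOfLength (Point.vertex w) (Point.vertex v) L

/-- Every vertex has finite degree. -/
def LocallyFinite (G : MetricGraph Vert Edge) : Prop :=
  ∀ v : Vert, {e | G.Incident e v}.Finite

/-- A positive vertex measure `μ` and a positive symmetric weight `ω` on pairs of adjacent
vertices. -/
structure VertexWeights (G : MetricGraph Vert Edge) where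
  μ : Vert → ℝ
  ω : Vert → Vert → ℝ
  μ_pos : ∀ v, 0 < μ v
  ω_pos : ∀ x y, G.Adj x y → 0 < ω x y
  ω_symm : ∀ x y, G.Adj x y → ω x y = ω y x

/-- The vertex Laplacian `(1 / μ x) ∑_{y ∼ x} ω x y (f y - f x)` (a finite sum on locally finite
graphs). -/
def vertexLaplacian (G : MetricGraph Vert Edge) (W : G.VertexWeights) (f : G.Point → ℝ)
    (x : Vert) : ℝ :=
  (1 / W.μ x) * ∑ᶠ y ∈ {y | G.Adj x y},
    W.ω x y * (f (Point.vertex y) - f (Point.vertex x))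

/-- The edge Laplacian: the second derivative of `f_e` at the coordinate `t ∈ (0, len e)`. -/
def edgeLaplacian (G : MetricGraph Vert Edge) (f : G.Point → ℝ) (e : Edge) (t : ℝ) : ℝ :=
  deriv (deriv (G.onEdge f e)) t

open Classical in
/-- The outer normal derivative of `f_e` at an endpoint `v` of `e`, taken one-sidedly. -/
def outerNormalDeriv (G : MetricGraph Vert Edge) (f : G.Point → ℝ) (e : Edge) (v : Vert) : ℝ :=
  if G.final e = v then derivWithin (G.onEdge f e) (Icc 0 (G.len e)) (G.len e)
  else -derivWithin (G.onEdge f e) (Icc 0 (G.len e)) 0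

/-- The sum of the outer normal derivatives of `f` at the vertex `v` over the edges ending there
(a finite sum on locally finite graphs). -/
def kirchhoff (G : MetricGraph Vert Edge) (f : G.Point → ℝ) (v : Vert) : ℝ :=
  ∑ᶠ e ∈ {e | G.Incident e v}, G.outerNormalDeriv f e v

/-- The space `𝒟(G)`: continuous functions with `f_e ∈ C²(I_e) ∩ C¹(closure I_e)` and
`f_e'' ∈ L^∞(I_e)` for every edge `e`. -/
structure MemD (G : MetricGraph Vert Edge) (f : G.Point → ℝ) : Prop where
  continuousOn : ∀ e, ContinuousOn (G.onEdge f e) (Icc 0 (G.len e))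
  contDiffOn_two : ∀ e, ContDiffOn ℝ 2 (G.onEdge f e) (Ioo 0 (G.len e))
  contDiffOn_one : ∀ e, ContDiffOn ℝ 1 (G.onEdge f e) (Icc 0 (G.len e))
  memLp_top : ∀ e, MemLp (G.edgeLaplacian f e) ⊤ (volume.restrict (Ioo 0 (G.len e)))

/-- `u` is a (possibly sign-changing) solution of `Δ_G u + P |u|^σ ≤ 0`: the inequality holds on
the edges for the edge Laplacian and at the vertices for the vertex Laplacian, and the Kirchhoff
(at vertices of degree one: Neumann) condition holds at every vertex. -/
structure IsSolution (G : MetricGraph Vert Edge) (W : G.VertexWeights) (P : G.Point → ℝ) (σ : ℝ)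
    (u : G.Point → ℝ) : Prop where
  memD : G.MemD u
  edge_le : ∀ e, ∀ t ∈ Ioo 0 (G.len e),
    G.edgeLaplacian u e t + G.onEdge P e t * |G.onEdge u e t| ^ σ ≤ 0
  vertex_le : ∀ x : Vert,
    G.vertexLaplacian W u x + P (Point.vertex x) * |u (Point.vertex x)| ^ σ ≤ 0
  kirchhoff_eq : ∀ x : Vert, G.kirchhoff u x = 0

/-- The weighted Lebesgue space `L^p_φ(G)`, `1 ≤ p < ∞`, of functions with finite norm
`(∑_v μ v φ v |f v|^p)^{1/p} + ∑_e (∫₀^{len e} |f_e|^p φ_e)^{1/p}`. -/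
def MemWeightedLp (G : MetricGraph Vert Edge) (W : G.VertexWeights) (p : ℝ)
    (φ f : G.Point → ℝ) : Prop :=
  (∀ e, AEMeasurable (G.onEdge f e) (volume.restrict (Ioo 0 (G.len e)))) ∧
  (∑' v : Vert, ENNReal.ofReal
      (W.μ v * φ (Point.vertex v) * |f (Point.vertex v)| ^ p)) ^ (1 / p) +
    ∑' e : Edge, (∫⁻ t in Ioo 0 (G.len e), ENNReal.ofReal
      (|G.onEdge f e t| ^ p * G.onEdge φ e t)) ^ (1 / p) < ⊤

/-- The space `X_α = L¹_φ(G)` with `φ x = exp (-α d(x, x₀))`. -/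
def MemX (G : MetricGraph Vert Edge) (W : G.VertexWeights) (x₀ : Vert) (α : ℝ)
    (f : G.Point → ℝ) : Prop :=
  G.MemWeightedLp W 1 (fun x => Real.exp (-α * G.dist x (Point.vertex x₀))) f

/-- The standing assumptions on the metric graph, with base vertex `x₀`. -/
structure Standing (G : MetricGraph Vert Edge) (W : G.VertexWeights) (x₀ : Vert) : Prop where
  infinite : Infinite Vert ∨ Infinite Edge
  connected : G.Connected
  locallyFinite : G.LocallyFinite
  no_loops : ∀ e, G.init e ≠ G.final e
  unbounded : ∃ x : ℕ → Vert,
    Tendsto (fun n => G.dist (Point.vertex (x n)) (Point.vertex x₀)) atTop atTop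
  finite_ball : ∀ R : ℝ, 0 < R →
    {v : Vert | Point.vertex v ∈ G.ball (Point.vertex x₀) R}.Finite ∧
    {e : Edge | ∃ t ∈ Ioo 0 (G.len e), G.pt e t ∈ G.ball (Point.vertex x₀) R}.Finite
  weight_le : ∃ C : ℝ, 0 < C ∧ ∀ x : Vert, ∑ᶠ y ∈ {y | G.Adj x y}, W.ω x y ≤ C * W.μ x
  len_bddAbove : BddAbove (range G.len)
  len_iInf_pos : 0 < ⨅ e, G.len e

/-- The radius `R₀ = max (2 j) 1`, where `j` is the supremum of the edge lengths. -/
def R₀ (G : MetricGraph Vert Edge) : ℝ :=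
  max (2 * ⨆ e, G.len e) 1

/-- The weighted growth condition: for every `R ≥ R₀`, with `α = δ / R` and with `δ` and `C`
independent of `R`, the sum of `μ P^{-1/(σ-1)} e^{-α d(·, x₀)}` over the vertices outside the
ball of radius `R` about `x₀`, and the integral of `P^{-1/(σ-1)} e^{-α d(·, x₀)}` over the edges
lying outside that ball, are at most `C R^{σ/(σ-1)}`. -/
def WeightedGrowth (G : MetricGraph Vert Edge) (W : G.VertexWeights) (x₀ : Vert)
    (P : G.Point → ℝ) (σ δ C : ℝ) : Prop :=
  ∀ R : ℝ, G.R₀ ≤ R →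
    (∑' v : {v : Vert // Point.vertex v ∉ G.ball (Point.vertex x₀) R},
        ENNReal.ofReal (W.μ v.1 * P (Point.vertex v.1) ^ (-(1 / (σ - 1))) *
          Real.exp (-(δ / R) * G.dist (Point.vertex v.1) (Point.vertex x₀)))
      ≤ ENNReal.ofReal (C * R ^ (σ / (σ - 1)))) ∧
    (∑' e : {e : Edge // ∀ t ∈ Ioo 0 (G.len e), G.pt e t ∉ G.ball (Point.vertex x₀) R},
        ∫⁻ t in Ioo 0 (G.len e.1),
          ENNReal.ofReal (G.onEdge P e.1 t ^ (-(1 / (σ - 1))) *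
            Real.exp (-(δ / R) * G.dist (G.pt e.1 t) (Point.vertex x₀)))
      ≤ ENNReal.ofReal (C * R ^ (σ / (σ - 1))))

end MetricGraph

end

/-!
The vertex inequality `Δ_V u + P |u|^σ ≤ 0` involves only the values of `u` at the vertices, and by
itself forces `u = 0` there (`MetricGraph.eq_zero_on_vertices`, from `discrete_liouville`). The
edges are then settled by concavity and the Kirchhoff condition
(`MetricGraph.IsSolution.eq_zero_of_vertices`).

For the vertices, let `d` be the distance to `x₀`, `α = δ / R`, and test the inequality with
`φ = exp (-α max (d - 2R) 0)`. Adjacent vertices have distances to `x₀` differing by at most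
`j = sup len`, so `|φ y - φ x| ≤ c φ x / R` across an edge, and `φ` is constant on the neighbours
of any vertex with `d < R`. If `u ∈ X_α`, summation by parts (`tsum_laplacian_symm`) gives, up to
constants,
`∑ μ P |u|^σ φ ≤ R⁻¹ ∑_{d ≥ R} μ |u| exp (-α d)` (`cutoff_energy_estimate`).
Hölder's inequality (`holder_tsum_weighted`) and the growth condition bound the right-hand side by
a constant times `(∑_{d ≥ R} μ P |u|^σ φ)^{1/σ}`, the powers of `R` cancelling exactly. Since
`1/σ < 1` the energies on the left are bounded independently of `R`; letting `R → ∞` gives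
`∑ μ P |u|^σ < ∞`. The tails therefore tend to zero, and the same estimate shows that the whole
sum is zero.

Letting `R → ∞` requires `u ∈ X_{δ/R}` for arbitrarily large `R`, whereas this is assumed only for
`R = R₁`. The energy estimate at `R` and the growth condition at `2R` together yield, again by
Hölder, `u ∈ X_{δ/(λR)}` with `λ = 2σ/(σ+1) > 1` (`weighted_integrability_improves`), and iterating
this reaches all `R = λⁿ R₁`.
-/

/-! ### Inequalities for sums and exponentials -/

lemma summable_and_tsum_le_of_ofReal {ι : Type*} {f : ι → ℝ} (hf : ∀ i, 0 ≤ f i) {c : ℝ}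
    (hc : 0 ≤ c) (h : ∑' i, ENNReal.ofReal (f i) ≤ ENNReal.ofReal c) :
    Summable f ∧ ∑' i, f i ≤ c := by
  have hs : ∀ s : Finset ι, ∑ i ∈ s, f i ≤ c := fun s => by
    rw [← ENNReal.ofReal_le_ofReal_iff hc, ENNReal.ofReal_sum_of_nonneg fun i _ => hf i]
    exact (ENNReal.sum_le_tsum s).trans h
  exact ⟨summable_of_sum_le hf hs, Real.tsum_le_of_sum_le hf hs⟩

lemma abs_exp_sub_one_le_mul_exp (z : ℝ) : |Real.exp z - 1| ≤ |z| * Real.exp |z| := by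
  have h1 := Real.add_one_le_exp z
  have h2 : (1 - z) * Real.exp z ≤ 1 := by
    have := Real.add_one_le_exp (-z)
    calc (1 - z) * Real.exp z ≤ Real.exp (-z) * Real.exp z := by gcongr; linarith
      _ = 1 := by rw [← Real.exp_add]; simp
  have h3 : z * Real.exp z ≤ |z| * Real.exp |z| :=
    mul_le_mul (le_abs_self z) (Real.exp_le_exp.2 (le_abs_self z)) (Real.exp_pos _).le
      (abs_nonneg z)
  have h4 : -z ≤ |z| * Real.exp |z| := by
    nlinarith [neg_le_abs z, abs_nonneg z, Real.one_le_exp (abs_nonneg z)]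
  rw [abs_le]
  constructor <;> linarith

/-- Hölder's inequality with exponents `σ` and `σ / (σ - 1)`, the potential `p` being split between
the two factors; the weights `a` and `b` may differ. -/
lemma holder_tsum_weighted {ι : Type*} {σ : ℝ} (hσ : 1 < σ) {m p a b v : ι → ℝ}
    (hm : ∀ x, 0 < m x) (hp : ∀ x, 0 < p x) (ha : ∀ x, 0 < a x) (hb : ∀ x, 0 < b x)
    (h1 : Summable fun x => m x * p x * |v x| ^ σ * a x)
    (h2 : Summable fun x => m x * p x ^ (-(1 / (σ - 1))) * b x) :
    (Summable fun x => m x * |v x| * (a x ^ (1 / σ) * b x ^ ((σ - 1) / σ))) ∧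
    ∑' x, m x * |v x| * (a x ^ (1 / σ) * b x ^ ((σ - 1) / σ)) ≤
      (∑' x, m x * p x * |v x| ^ σ * a x) ^ (1 / σ) *
      (∑' x, m x * p x ^ (-(1 / (σ - 1))) * b x) ^ ((σ - 1) / σ) := by
  have hσ0 : σ ≠ 0 := by linarith
  have hσ1 : σ - 1 ≠ 0 := by linarith
  have hpq : σ.HolderConjugate (σ / (σ - 1)) := Real.HolderConjugate.conjExponent hσ
  have n1 : ∀ x, 0 ≤ m x * p x * |v x| ^ σ * a x := fun x => by
    have := hm x; have := hp x; have := ha x; positivity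
  have n2 : ∀ x, 0 ≤ m x * p x ^ (-(1 / (σ - 1))) * b x := fun x => by
    have := hm x; have := hp x; have := hb x; positivity
  have r1 : ∀ x, ((m x * p x * |v x| ^ σ * a x) ^ (1 / σ)) ^ σ = m x * p x * |v x| ^ σ * a x :=
    fun x => by rw [← Real.rpow_mul (n1 x), one_div_mul_cancel hσ0, Real.rpow_one]
  have r2 : ∀ x, ((m x * p x ^ (-(1 / (σ - 1))) * b x) ^ ((σ - 1) / σ)) ^ (σ / (σ - 1)) =
      m x * p x ^ (-(1 / (σ - 1))) * b x := fun x => by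
    rw [← Real.rpow_mul (n2 x), div_mul_div_cancel₀ hσ0, div_self hσ1, Real.rpow_one]
  have r3 : ∀ x, (m x * p x * |v x| ^ σ * a x) ^ (1 / σ) *
      (m x * p x ^ (-(1 / (σ - 1))) * b x) ^ ((σ - 1) / σ) =
      m x * |v x| * (a x ^ (1 / σ) * b x ^ ((σ - 1) / σ)) := fun x => by
    have hm' := (hm x).le
    have hp' := (hp x).le
    have ha' := (ha x).le
    have hb' := (hb x).le
    rw [Real.mul_rpow (by positivity) ha', Real.mul_rpow (by positivity) (by positivity),
      Real.mul_rpow hm' hp', Real.mul_rpow (by positivity) hb',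
      Real.mul_rpow hm' (by positivity), ← Real.rpow_mul (abs_nonneg _), ← Real.rpow_mul hp',
      mul_one_div_cancel hσ0, Real.rpow_one]
    have e1 : m x ^ (1 / σ) * m x ^ ((σ - 1) / σ) = m x := by
      rw [← Real.rpow_add (hm x), ← add_div, add_sub_cancel, div_self hσ0, Real.rpow_one]
    have e2 : p x ^ (1 / σ) * p x ^ (-(1 / (σ - 1)) * ((σ - 1) / σ)) = 1 := by
      rw [← Real.rpow_add (hp x),
        show 1 / σ + -(1 / (σ - 1)) * ((σ - 1) / σ) = 0 by field_simp; ring, Real.rpow_zero]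
    calc _ = (m x ^ (1 / σ) * m x ^ ((σ - 1) / σ)) *
          (p x ^ (1 / σ) * p x ^ (-(1 / (σ - 1)) * ((σ - 1) / σ))) *
          |v x| * (a x ^ (1 / σ) * b x ^ ((σ - 1) / σ)) := by ring
      _ = _ := by rw [e1, e2, mul_one]
  have key := Real.summable_and_inner_le_Lp_mul_Lq_tsum_of_nonneg hpq
    (f := fun x => (m x * p x * |v x| ^ σ * a x) ^ (1 / σ))
    (g := fun x => (m x * p x ^ (-(1 / (σ - 1))) * b x) ^ ((σ - 1) / σ))
    (fun x => Real.rpow_nonneg (n1 x) _) (fun x => Real.rpow_nonneg (n2 x) _)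
    (by simpa only [r1] using h1) (by simpa only [r2] using h2)
  simpa only [r1, r2, r3, one_div_div] using key

/-! ### Summation by parts for a weighted graph Laplacian -/

section Discrete

variable {ι : Type*} {k : ι → ι → ℝ} {m u φ : ι → ℝ}

lemma summable_kernel_mul (hk : ∀ x y, 0 ≤ k x y)
    (hfin : ∀ x, (Function.support (k x)).Finite) {C₀ : ℝ}
    (hC : ∀ x, ∑' y, k x y ≤ C₀ * m x) {v w : ι → ℝ} {K : ℝ} (hK : 0 ≤ K)
    (h : ∀ x y, k x y ≠ 0 → |w y| ≤ K * |w x|)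
    (hs : Summable fun x => m x * |v x * w x|) :
    Summable fun z : ι × ι => k z.1 z.2 * v z.1 * w z.2 := by
  have hrow : ∀ x, Summable (k x) := fun x => summable_of_hasFiniteSupport (hfin x)
  have hle : ∀ x y, |k x y * v x * w y| ≤ k x y * (K * |v x * w x|) := fun x y => by
    rcases eq_or_ne (k x y) 0 with h0 | h0
    · simp [h0]
    · rw [abs_mul, abs_mul, abs_mul, abs_of_nonneg (hk x y), mul_assoc]
      refine mul_le_mul_of_nonneg_left ?_ (hk x y)
      nlinarith [mul_le_mul_of_nonneg_left (h x y h0) (abs_nonneg (v x))]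
  have hnn : ∀ x y, 0 ≤ k x y * (K * |v x * w x|) := fun x y =>
    mul_nonneg (hk x y) (mul_nonneg hK (abs_nonneg _))
  have hbig : Summable fun z : ι × ι => k z.1 z.2 * (K * |v z.1 * w z.1|) := by
    refine (summable_prod_of_nonneg (f := fun z : ι × ι => k z.1 z.2 * (K * |v z.1 * w z.1|))
      (fun z => hnn z.1 z.2)).2 ⟨fun x => (hrow x).mul_right (K * |v x * w x|), ?_⟩
    refine Summable.of_nonneg_of_le (fun x => tsum_nonneg fun y =>
      hnn x y) (fun x => ?_) (hs.mul_left (C₀ * K))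
    calc ∑' y, k x y * (K * |v x * w x|) = (∑' y, k x y) * (K * |v x * w x|) := tsum_mul_right
      _ ≤ (C₀ * m x) * (K * |v x * w x|) := 
          mul_le_mul_of_nonneg_right (hC x) (mul_nonneg hK (abs_nonneg _))
      _ = C₀ * K * (m x * |v x * w x|) := by ring
  exact Summable.of_norm_bounded hbig fun z => hle z.1 z.2

/-- Green's formula for `f ↦ ∑ y, k x y * (f y - f x)`, for pairs `u`, `φ` whose product is
`m`-integrable; neither need have finite support, but `φ` may grow at most by a fixed factor from
a point to its neighbours. -/
lemma tsum_laplacian_symm (hk : ∀ x y, 0 ≤ k x y) (hsymm : ∀ x y, k x y = k y x)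
    (hfin : ∀ x, (Function.support (k x)).Finite) {C₀ : ℝ}
    (hC : ∀ x, ∑' y, k x y ≤ C₀ * m x) {K : ℝ} (hK : 0 ≤ K)
    (h : ∀ x y, k x y ≠ 0 → |φ y| ≤ K * |φ x|)
    (hs : Summable fun x => m x * |u x * φ x|) :
    (Summable fun x => φ x * ∑' y, k x y * (u y - u x)) ∧
    (Summable fun x => u x * ∑' y, k x y * (φ y - φ x)) ∧
    ∑' x, φ x * ∑' y, k x y * (u y - u x) = ∑' x, u x * ∑' y, k x y * (φ y - φ x) := by
  have hrow : ∀ x (f : ι → ℝ), Summable fun y => k x y * f y := fun x f =>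
    summable_of_hasFiniteSupport ((hfin x).subset fun y hy => left_ne_zero_of_mul hy)
  have h1 := summable_kernel_mul hk hfin hC hK h hs
  have h2 : Summable fun z : ι × ι => k z.1 z.2 * φ z.1 * u z.2 := by
    refine (h1.prod_symm).congr fun z => ?_
    simp only [Prod.fst_swap, Prod.snd_swap, hsymm z.2 z.1]; ring
  have h3 : Summable fun x => u x * φ x * ∑' y, k x y := by
    refine Summable.of_norm_bounded (hs.mul_left C₀) fun x => ?_
    rw [Real.norm_eq_abs, abs_mul, abs_of_nonneg (tsum_nonneg (hk x))]
    nlinarith [mul_le_mul_of_nonneg_left (hC x) (abs_nonneg (u x * φ x))]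
  have e1 : ∀ x, u x * ∑' y, k x y * (φ y - φ x) =
      (∑' y, k x y * u x * φ y) - u x * φ x * ∑' y, k x y := fun x => by
    rw [← tsum_mul_left, ← tsum_mul_left, ← Summable.tsum_sub]
    · exact tsum_congr fun y => by ring
    · exact ((hrow x φ).mul_left (u x)).congr fun y => by ring
    · exact (summable_of_hasFiniteSupport (hfin x)).mul_left _
  have e2 : ∀ x, φ x * ∑' y, k x y * (u y - u x) =
      (∑' y, k x y * φ x * u y) - u x * φ x * ∑' y, k x y := fun x => by
    rw [← tsum_mul_left, ← tsum_mul_left, ← Summable.tsum_sub]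
    · exact tsum_congr fun y => by ring
    · exact ((hrow x u).mul_left (φ x)).congr fun y => by ring
    · exact (summable_of_hasFiniteSupport (hfin x)).mul_left _
  have s1 : Summable fun x => ∑' y, k x y * u x * φ y := h1.prod
  have s2 : Summable fun x => ∑' y, k x y * φ x * u y := h2.prod
  simp only [e1, e2]
  refine ⟨s2.sub h3, s1.sub h3, ?_⟩
  rw [s2.tsum_sub h3, s1.tsum_sub h3]
  congr 1
  refine (Summable.tsum_comm (f := fun x y => k x y * φ x * u y) h2).symm.trans ?_
  exact tsum_congr fun x => tsum_congr fun y => by rw [hsymm y x]; ring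

/-- Testing the inequality for `u` against a positive `φ` and moving the Laplacian onto `φ`. Only
the points of `A`, off which `φ` is locally constant, contribute to the right-hand side. -/
lemma energy_estimate (hk : ∀ x y, 0 ≤ k x y) (hsymm : ∀ x y, k x y = k y x)
    (hfin : ∀ x, (Function.support (k x)).Finite) {C₀ : ℝ}
    (hC : ∀ x, ∑' y, k x y ≤ C₀ * m x) (hφ : ∀ x, 0 < φ x)
    {F : ι → ℝ} (hF : ∀ x, 0 ≤ F x)
    (hsol : ∀ x, F x + ∑' y, k x y * (u y - u x) ≤ 0)
    (hs : Summable fun x => m x * |u x| * φ x) {ε : ℝ} (hε : 0 ≤ ε)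
    (hgrad : ∀ x y, k x y ≠ 0 → |φ y - φ x| ≤ ε * φ x)
    (A : Set ι) (hA : ∀ x ∉ A, ∀ y, k x y ≠ 0 → φ y = φ x) :
    (Summable fun x => F x * φ x) ∧
    ∑' x, F x * φ x ≤ C₀ * ε * ∑' x : A, m x * |u x| * φ x := by
  have hrow : ∀ x (f : ι → ℝ), Summable fun y => k x y * f y := fun x f =>
    summable_of_hasFiniteSupport ((hfin x).subset fun y hy => left_ne_zero_of_mul hy)
  obtain ⟨s1, s2, he⟩ := tsum_laplacian_symm (K := 1 + ε) (u := u) (φ := φ) hk hsymm hfin hC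
    (by linarith)
    (fun x y h => by
      rw [abs_of_pos (hφ x), abs_of_pos (hφ y)]
      linarith [(abs_le.1 (hgrad x y h)).2])
    (hs.congr fun x => by rw [abs_mul, abs_of_pos (hφ x)]; ring)
  have hle : ∀ x, F x * φ x ≤ -(φ x * ∑' y, k x y * (u y - u x)) := fun x => by
    nlinarith [hsol x, hφ x]
  have hsum : Summable fun x => F x * φ x :=
    Summable.of_nonneg_of_le (fun x => mul_nonneg (hF x) (hφ x).le) hle s1.neg
  refine ⟨hsum, ?_⟩
  have hpt : ∀ x, -(u x * ∑' y, k x y * (φ y - φ x)) ≤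
      C₀ * ε * A.indicator (fun x => m x * |u x| * φ x) x := fun x => by
    by_cases hx : x ∈ A
    · rw [indicator_of_mem hx]
      have hb : |∑' y, k x y * (φ y - φ x)| ≤ C₀ * m x * (ε * φ x) := by
        have hb1 : |∑' y, k x y * (φ y - φ x)| ≤ ∑' y, k x y * (ε * φ x) := by
          rw [abs_le]
          have hy : ∀ y, |k x y * (φ y - φ x)| ≤ k x y * (ε * φ x) := fun y => by
            rcases eq_or_ne (k x y) 0 with h0 | h0
            · simp [h0]
            · rw [abs_mul, abs_of_nonneg (hk x y)]
              exact mul_le_mul_of_nonneg_left (hgrad x y h0) (hk x y)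
          constructor
          · rw [← tsum_neg]
            exact Summable.tsum_le_tsum (fun y => (abs_le.1 (hy y)).1) (hrow x _).neg (hrow x _)
          · exact Summable.tsum_le_tsum (fun y => (abs_le.1 (hy y)).2) (hrow x _) (hrow x _)
        rw [tsum_mul_right] at hb1
        exact hb1.trans (mul_le_mul_of_nonneg_right (hC x) (mul_nonneg hε (hφ x).le))
      calc -(u x * ∑' y, k x y * (φ y - φ x)) ≤ |u x * ∑' y, k x y * (φ y - φ x)| :=
            neg_le_abs _
        _ = |u x| * |∑' y, k x y * (φ y - φ x)| := abs_mul _ _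
        _ ≤ |u x| * (C₀ * m x * (ε * φ x)) := mul_le_mul_of_nonneg_left hb (abs_nonneg _)
        _ = _ := by ring
    · have h0 : ∀ y, k x y * (φ y - φ x) = 0 := fun y => by
        rcases eq_or_ne (k x y) 0 with h0 | h0
        · simp [h0]
        · rw [hA x hx y h0, sub_self, mul_zero]
      simp [h0, indicator_of_notMem hx]
  calc ∑' x, F x * φ x ≤ ∑' x, -(φ x * ∑' y, k x y * (u y - u x)) :=
        hsum.tsum_le_tsum hle s1.neg
    _ = ∑' x, -(u x * ∑' y, k x y * (φ y - φ x)) := by rw [tsum_neg, tsum_neg, he]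
    _ ≤ ∑' x, C₀ * ε * A.indicator (fun x => m x * |u x| * φ x) x :=
        Summable.tsum_le_tsum hpt s2.neg ((hs.indicator A).mul_left _)
    _ = _ := by rw [tsum_mul_left, tsum_subtype A (fun x => m x * |u x| * φ x)]

end Discrete

lemma abs_cutoff_sub_le {α r j a b : ℝ} (hα : 0 ≤ α) (hj : |b - a| ≤ j) :
    |Real.exp (-α * max (b - r) 0) - Real.exp (-α * max (a - r) 0)| ≤
      α * j * Real.exp (α * j) * Real.exp (-α * max (a - r) 0) := by
  set z := -α * max (b - r) 0 - -α * max (a - r) 0 with hz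
  have hz' : |z| ≤ α * j := by
    have : z = -α * (max (b - r) 0 - max (a - r) 0) := by rw [hz]; ring
    rw [this, abs_mul, abs_neg, abs_of_nonneg hα]
    refine mul_le_mul_of_nonneg_left (le_trans ?_ hj) hα
    simpa using abs_max_sub_max_le_abs (b - r) (a - r) 0
  have e : Real.exp (-α * max (b - r) 0) - Real.exp (-α * max (a - r) 0) =
      (Real.exp z - 1) * Real.exp (-α * max (a - r) 0) := by
    rw [sub_mul, ← Real.exp_add, hz, sub_add_cancel, one_mul]
  rw [e, abs_mul, abs_of_pos (Real.exp_pos (-α * _))]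
  refine mul_le_mul_of_nonneg_right ((abs_exp_sub_one_le_mul_exp z).trans ?_) (Real.exp_pos _).le
  exact mul_le_mul hz' (Real.exp_le_exp.2 hz') (Real.exp_pos _).le ((abs_nonneg z).trans hz')

/-! ### The Liouville theorem for weighted graphs -/

section Discrete

variable {ι : Type*} {k : ι → ι → ℝ} {m d u p : ι → ℝ}

/-- `energy_estimate` for the test function `exp (-(δ / R) * max (d - 2R) 0)`. The plateau has
radius `2R` rather than `R` so that all neighbours of a point with `d x < R` still lie in it. -/
lemma cutoff_energy_estimate (hk : ∀ x y, 0 ≤ k x y) (hsymm : ∀ x y, k x y = k y x)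
    (hfin : ∀ x, (Function.support (k x)).Finite) {C₀ : ℝ} (hC₀ : 0 ≤ C₀)
    (hC : ∀ x, ∑' y, k x y ≤ C₀ * m x) (hm : ∀ x, 0 < m x)
    {j : ℝ} (hj : 0 ≤ j) (hd : ∀ x y, k x y ≠ 0 → |d y - d x| ≤ j)
    {F : ι → ℝ} (hF : ∀ x, 0 ≤ F x)
    (hsol : ∀ x, F x + ∑' y, k x y * (u y - u x) ≤ 0)
    {δ R : ℝ} (hδ : 0 < δ) (hR : 0 < R) (hjR : j ≤ R)
    (hs : Summable fun x => m x * |u x| * Real.exp (-(δ / R) * d x)) :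
    (Summable fun x => F x * Real.exp (-(δ / R) * max (d x - 2 * R) 0)) ∧
    ∑' x, F x * Real.exp (-(δ / R) * max (d x - 2 * R) 0) ≤
      C₀ * (δ / R * j * Real.exp δ) * (Real.exp (2 * δ) *
        ∑' x : {x // ¬ d x < R}, m x * |u x| * Real.exp (-(δ / R) * d x)) := by
  have hα : 0 ≤ δ / R := by positivity
  have hφle : ∀ x, Real.exp (-(δ / R) * max (d x - 2 * R) 0) ≤
      Real.exp (2 * δ) * Real.exp (-(δ / R) * d x) := fun x => by
    rw [← Real.exp_add, Real.exp_le_exp]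
    have h1 : δ / R * (d x - 2 * R) ≤ δ / R * max (d x - 2 * R) 0 :=
      mul_le_mul_of_nonneg_left (le_max_left _ _) hα
    have h2 : δ / R * (2 * R) = 2 * δ := by field_simp
    linarith
  have hle : ∀ x, m x * |u x| * Real.exp (-(δ / R) * max (d x - 2 * R) 0) ≤
      Real.exp (2 * δ) * (m x * |u x| * Real.exp (-(δ / R) * d x)) := fun x => by
    have h0 : 0 ≤ m x * |u x| := mul_nonneg (hm x).le (abs_nonneg _)
    nlinarith [mul_le_mul_of_nonneg_left (hφle x) h0]
  have hs' : Summable fun x => m x * |u x| * Real.exp (-(δ / R) * max (d x - 2 * R) 0) :=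
    Summable.of_nonneg_of_le (fun x => mul_nonneg (mul_nonneg (hm x).le (abs_nonneg _))
      (Real.exp_pos _).le) hle (hs.mul_left _)
  have hε : δ / R * j * Real.exp (δ / R * j) ≤ δ / R * j * Real.exp δ := by
    refine mul_le_mul_of_nonneg_left (Real.exp_le_exp.2 ?_) (by positivity)
    calc δ / R * j ≤ δ / R * R := mul_le_mul_of_nonneg_left hjR hα
      _ = δ := by field_simp
  obtain ⟨h1, h2⟩ := energy_estimate (φ := fun x => Real.exp (-(δ / R) * max (d x - 2 * R) 0))
    (ε := δ / R * j * Real.exp δ) hk hsymm hfin hC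
    (fun x => Real.exp_pos _) hF hsol hs' (by positivity)
    (fun x y h => (abs_cutoff_sub_le hα (hd x y h)).trans
      (mul_le_mul_of_nonneg_right hε (Real.exp_pos _).le))
    {x | ¬ d x < R} (fun x hx y h => by
      simp only [mem_ofPred_eq, not_not] at hx
      have := (abs_le.1 (hd x y h)).2
      have e1 : max (d x - 2 * R) 0 = 0 := max_eq_right (by linarith)
      have e2 : max (d y - 2 * R) 0 = 0 := max_eq_right (by linarith)
      simp only [e1, e2])
  refine ⟨h1, h2.trans (mul_le_mul_of_nonneg_left ?_ (by positivity))⟩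
  rw [← tsum_mul_left]
  exact Summable.tsum_le_tsum (fun x => hle x.1) (hs'.subtype _) ((hs.mul_left _).subtype _)

/-- Finite energy with decay rate `δ / R`, combined with the growth condition at radius `2R`, puts
`u` in the smaller weighted space with decay rate `δ / (λ R)`, where
`1 / λ = 1 / σ + (σ - 1) / (2 σ)`, so that `λ = 2σ / (σ + 1) > 1`. -/
lemma weighted_integrability_improves {σ : ℝ} (hσ : 1 < σ) (hm : ∀ x, 0 < m x)
    (hp : ∀ x, 0 < p x) {δ R : ℝ} (hR : 0 < R)
    (hball : {x | d x < 2 * R}.Finite)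
    (h1 : Summable fun x => m x * p x * |u x| ^ σ * Real.exp (-(δ / R) * d x))
    (h2 : Summable fun x : {x // ¬ d x < 2 * R} =>
      m x * p x ^ (-(1 / (σ - 1))) * Real.exp (-(δ / (2 * R)) * d x)) :
    Summable fun x => m x * |u x| * Real.exp (-(δ / (2 * σ / (σ + 1) * R)) * d x) := by
  have h2' : Summable fun x => m x * p x ^ (-(1 / (σ - 1))) * Real.exp (-(δ / (2 * R)) * d x) :=
    hball.summable_compl_iff.1 h2
  refine (holder_tsum_weighted hσ hm hp (fun x => Real.exp_pos _) (fun x => Real.exp_pos _)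
    h1 h2').1.congr fun x => ?_
  rw [← Real.exp_mul, ← Real.exp_mul, ← Real.exp_add]
  congr 2
  have : σ ≠ 0 := by linarith
  have : σ + 1 ≠ 0 := by linarith
  field_simp
  ring

lemma le_rpow_of_le_mul_rpow {σ S K : ℝ} (hσ : 1 < σ) (hS : 0 ≤ S) (hK : 0 ≤ K)
    (h : S ≤ K * S ^ (1 / σ)) : S ≤ K ^ (σ / (σ - 1)) := by
  rcases hS.eq_or_lt with rfl | hS
  · positivity
  have h1 : S ^ ((σ - 1) / σ) ≤ K := by
    have e : S ^ ((σ - 1) / σ) * S ^ (1 / σ) = S := by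
      rw [← Real.rpow_add hS, ← add_div, sub_add_cancel, div_self (by linarith), Real.rpow_one]
    exact le_of_mul_le_mul_right (e.trans_le h) (Real.rpow_pos_of_pos hS _)
  have hσ1 : 0 < σ - 1 := by linarith
  calc S = (S ^ ((σ - 1) / σ)) ^ (σ / (σ - 1)) := by
        rw [← Real.rpow_mul hS.le, div_mul_div_cancel₀ (by linarith), div_self hσ1.ne',
          Real.rpow_one]
    _ ≤ _ := Real.rpow_le_rpow (by positivity) h1 (by positivity)

/-- The Liouville theorem for the operator `f ↦ ∑ y, k x y * (f y - f x)`, with a function `d` of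
bounded jumps and finite sublevel sets in the role of the distance to a base point. -/
theorem discrete_liouville (hk : ∀ x y, 0 ≤ k x y) (hsymm : ∀ x y, k x y = k y x)
    (hfin : ∀ x, (Function.support (k x)).Finite) {C₀ : ℝ} (hC₀ : 0 ≤ C₀)
    (hC₀k : ∀ x, ∑' y, k x y ≤ C₀ * m x) (hm : ∀ x, 0 < m x) (hd0 : ∀ x, 0 ≤ d x)
    {j : ℝ} (hj : 0 ≤ j) (hd : ∀ x y, k x y ≠ 0 → |d y - d x| ≤ j)
    (hball : ∀ R, {x | d x < R}.Finite) {σ : ℝ} (hσ : 1 < σ) (hp : ∀ x, 0 < p x)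
    {δ C R₀ : ℝ} (hδ : 0 < δ) (hC : 0 ≤ C) (hR₀ : 0 < R₀) (hjR₀ : j ≤ R₀)
    (hgrowth : ∀ R, R₀ ≤ R →
      (Summable fun x : {x // ¬ d x < R} =>
        m x * p x ^ (-(1 / (σ - 1))) * Real.exp (-(δ / R) * d x)) ∧
      ∑' x : {x // ¬ d x < R}, m x * p x ^ (-(1 / (σ - 1))) * Real.exp (-(δ / R) * d x) ≤
        C * R ^ (σ / (σ - 1)))
    (hsol : ∀ x, m x * p x * |u x| ^ σ + ∑' y, k x y * (u y - u x) ≤ 0)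
    {R₁ : ℝ} (hR₁ : R₀ ≤ R₁)
    (hu : Summable fun x => m x * |u x| * Real.exp (-(δ / R₁) * d x)) (x : ι) : u x = 0 := by
  set E : ι → ℝ := fun x => m x * p x * |u x| ^ σ with hE
  have hE0 : ∀ x, 0 ≤ E x := fun x => by
    have := hm x; have := hp x; positivity
  have hσ0 : 0 < σ := by linarith
  have hσ1 : 0 < σ - 1 := by linarith
  set r : ℝ := 2 * σ / (σ + 1) with hr
  have hr1 : 1 < r := by rw [hr, lt_div_iff₀ (by linarith)]; linarith
  -- The energy with the weight `exp (-(δ / R) d)` is finite as soon as `u` is integrable.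
  have hEsum : ∀ R, R₀ ≤ R → (Summable fun x => m x * |u x| * Real.exp (-(δ / R) * d x)) →
      Summable fun x => m x * p x * |u x| ^ σ * Real.exp (-(δ / R) * d x) := fun R hR h => by
    have hRpos := hR₀.trans_le hR
    refine Summable.of_nonneg_of_le (fun x => mul_nonneg (hE0 x) (Real.exp_pos _).le)
      (fun x => mul_le_mul_of_nonneg_left (Real.exp_le_exp.2 ?_) (hE0 x))
      (cutoff_energy_estimate hk hsymm hfin hC₀ hC₀k hm hj hd hE0 hsol hδ hRpos
        (hjR₀.trans hR) h).1
    have h1 : max (d x - 2 * R) 0 ≤ d x := max_le (by linarith) (hd0 x)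
    have h2 : 0 ≤ δ / R := by positivity
    nlinarith
  -- Along the radii `r ^ n * R₁` the integrability of `u` propagates from each one to the next.
  set ρ : ℕ → ℝ := fun n => r ^ n * R₁ with hρ
  have hρR : ∀ n, R₀ ≤ ρ n := fun n =>
    hR₁.trans (le_mul_of_one_le_left (hR₀.le.trans hR₁) (one_le_pow₀ hr1.le))
  have hρpos : ∀ n, 0 < ρ n := fun n => hR₀.trans_le (hρR n)
  have hρtop : Tendsto ρ atTop atTop :=
    (tendsto_pow_atTop_atTop_of_one_lt hr1).atTop_mul_const (hR₀.trans_le hR₁)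
  have hun : ∀ n, Summable fun x => m x * |u x| * Real.exp (-(δ / ρ n) * d x) := fun n => by
    induction n with
    | zero => simpa [hρ] using hu
    | succ n ih =>
      have h2 := (hgrowth (2 * ρ n) (by linarith [hρR n, hρpos n])).1
      have := weighted_integrability_improves hσ hm hp (hρpos n) (hball _)
        (hEsum _ (hρR n) ih) h2
      have e : ρ (n + 1) = 2 * σ / (σ + 1) * ρ n := by simp only [hρ, hr, pow_succ]; ring
      rwa [e]
  set φ : ℕ → ι → ℝ := fun n x => Real.exp (-(δ / ρ n) * max (d x - 2 * ρ n) 0) with hφ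
  set S : ℕ → ℝ := fun n => ∑' x, E x * φ n x with hS
  set K : ℝ := C₀ * (δ * j * Real.exp δ) * (Real.exp (2 * δ) * C ^ ((σ - 1) / σ)) with hK
  have hK0 : 0 ≤ K := by positivity
  have hφ1 : ∀ n x, φ n x ≤ 1 := fun n x => by
    have h1 : 0 ≤ δ / ρ n := (div_pos hδ (hρpos n)).le
    have h2 : 0 ≤ max (d x - 2 * ρ n) 0 := le_max_right _ _
    exact Real.exp_le_one_iff.2 (by nlinarith)
  have hφle : ∀ n x, Real.exp (-(δ / ρ n) * d x) ≤ φ n x := fun n x => by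
    refine Real.exp_le_exp.2 ?_
    have h1 : max (d x - 2 * ρ n) 0 ≤ d x := max_le (by linarith [hρpos n]) (hd0 x)
    have h2 : 0 ≤ δ / ρ n := (div_pos hδ (hρpos n)).le
    nlinarith
  have hφeq : ∀ x, ∀ᶠ n in atTop, φ n x = 1 := fun x => by
    filter_upwards [hρtop.eventually_ge_atTop (d x)] with n hn
    have : max (d x - 2 * ρ n) 0 = 0 := max_eq_right (by linarith [hρpos n])
    simp [hφ, this]
  have hSsum : ∀ n, Summable fun x => E x * φ n x := fun n =>
    (cutoff_energy_estimate hk hsymm hfin hC₀ hC₀k hm hj hd hE0 hsol hδ (hρpos n)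
      (hjR₀.trans (hρR n)) (hun n)).1
  have hSφ0 : ∀ n x, 0 ≤ E x * φ n x := fun n x => mul_nonneg (hE0 x) (Real.exp_pos _).le
  -- The powers of `R` from the Laplacian of the cutoff and from the growth condition cancel.
  have hST : ∀ n, S n ≤ K * (∑' x : {x // ¬ d x < ρ n}, E x * φ n x) ^ (1 / σ) := fun n => by
    have h1 := (cutoff_energy_estimate hk hsymm hfin hC₀ hC₀k hm hj hd hE0 hsol hδ (hρpos n)
      (hjR₀.trans (hρR n)) (hun n)).2
    have h2 := (holder_tsum_weighted (ι := {x // ¬ d x < ρ n}) hσ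
      (m := fun x => m x) (p := fun x => p x) (v := fun x => u x)
      (a := fun x => Real.exp (-(δ / ρ n) * d x)) (b := fun x => Real.exp (-(δ / ρ n) * d x))
      (fun x => hm x) (fun x => hp x) (fun x => Real.exp_pos _) (fun x => Real.exp_pos _)
      ((hEsum _ (hρR n) (hun n)).subtype _) (hgrowth _ (hρR n)).1).2
    have e1 : ∀ x : ι, Real.exp (-(δ / ρ n) * d x) ^ (1 / σ) *
        Real.exp (-(δ / ρ n) * d x) ^ ((σ - 1) / σ) = Real.exp (-(δ / ρ n) * d x) := fun x => by
      rw [← Real.rpow_add (Real.exp_pos _), ← add_div, add_sub_cancel, div_self hσ0.ne',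
        Real.rpow_one]
    simp only [e1] at h2
    have h3 : (∑' x : {x // ¬ d x < ρ n}, m x * p x * |u x| ^ σ * Real.exp (-(δ / ρ n) * d x))
        ^ (1 / σ) ≤ (∑' x : {x // ¬ d x < ρ n}, E x * φ n x) ^ (1 / σ) := by
      refine Real.rpow_le_rpow (tsum_nonneg fun x => mul_nonneg (hE0 x) (Real.exp_pos _).le)
        ?_ (by positivity)
      exact Summable.tsum_le_tsum (fun x => mul_le_mul_of_nonneg_left (hφle n x) (hE0 x))
        ((hEsum _ (hρR n) (hun n)).subtype _) ((hSsum n).subtype _)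
    have h4 : (∑' x : {x // ¬ d x < ρ n},
        m x * p x ^ (-(1 / (σ - 1))) * Real.exp (-(δ / ρ n) * d x)) ^ ((σ - 1) / σ) ≤
        C ^ ((σ - 1) / σ) * ρ n := by
      calc _ ≤ (C * ρ n ^ (σ / (σ - 1))) ^ ((σ - 1) / σ) := by
            refine Real.rpow_le_rpow (tsum_nonneg fun x => ?_) (hgrowth _ (hρR n)).2
              (by positivity)
            have := hm x; have := hp x; positivity
        _ = _ := by
            have := (hρpos n).le
            rw [Real.mul_rpow hC (by positivity), ← Real.rpow_mul this,
              div_mul_div_cancel₀ hσ1.ne', div_self hσ0.ne', Real.rpow_one]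
    have hT0 : 0 ≤ ∑' x : {x // ¬ d x < ρ n}, E x * φ n x := tsum_nonneg fun x => hSφ0 n x
    have h5 := h2.trans (mul_le_mul h3 h4 (Real.rpow_nonneg (tsum_nonneg fun x => by
      have := hm x; have := hp x; positivity) _) (Real.rpow_nonneg hT0 _))
    have hρn := hρpos n
    calc S n ≤ _ := h1
      _ ≤ C₀ * (δ / ρ n * j * Real.exp δ) * (Real.exp (2 * δ) *
          ((∑' x : {x // ¬ d x < ρ n}, E x * φ n x) ^ (1 / σ) * (C ^ ((σ - 1) / σ) * ρ n))) := by
        gcongr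
      _ = _ := by rw [hK]; field_simp
  have hTS : ∀ n, ∑' x : {x // ¬ d x < ρ n}, E x * φ n x ≤ S n := fun n =>
    Summable.tsum_subtype_le (fun x => E x * φ n x) {x | ¬ d x < ρ n} (hSφ0 n) (hSsum n)
  -- Absorbing the tail into the left-hand side bounds the energies uniformly in `n`.
  have hSbdd : ∀ n, S n ≤ K ^ (σ / (σ - 1)) := fun n => by
    refine le_rpow_of_le_mul_rpow hσ (tsum_nonneg (hSφ0 n)) hK0 ((hST n).trans ?_)
    exact mul_le_mul_of_nonneg_left (Real.rpow_le_rpow (tsum_nonneg fun x => hSφ0 n x) (hTS n)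
      (by positivity)) hK0
  have hEs : Summable E := by
    refine summable_of_sum_le hE0 (c := K ^ (σ / (σ - 1))) fun s => ?_
    obtain ⟨n, hn⟩ := ((Filter.eventually_all_finset s).2 fun x _ => hφeq x).exists
    calc ∑ x ∈ s, E x = ∑ x ∈ s, E x * φ n x :=
          Finset.sum_congr rfl fun x hx => by rw [hn x hx, mul_one]
      _ ≤ S n := (hSsum n).sum_le_tsum s fun x _ => hSφ0 n x
      _ ≤ _ := hSbdd n
  -- The total energy is finite, so its tails vanish, and `hST` then kills the energy itself.
  have hT : Tendsto (fun n => ∑' x : {x // ¬ d x < ρ n}, E x * φ n x) atTop (𝓝 0) := by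
    have h := tendsto_tsum_of_dominated_convergence (𝓕 := (atTop : Filter ℕ)) (bound := E)
      (f := fun n => {x | ¬ d x < ρ n}.indicator fun x => E x * φ n x) (g := fun _ => 0) hEs
      (fun x => ?_) (Eventually.of_forall fun n x => ?_)
    · rw [tsum_zero] at h
      exact h.congr fun n => (tsum_subtype {x | ¬ d x < ρ n} fun x => E x * φ n x).symm
    · refine tendsto_const_nhds.congr' ?_
      filter_upwards [hρtop.eventually_gt_atTop (d x)] with n hn
      rw [indicator_of_notMem]
      simpa using hn
    · rw [Real.norm_eq_abs, abs_of_nonneg (indicator_nonneg (fun x _ => hSφ0 n x) x)]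
      refine (indicator_le_self' (fun _ _ => hSφ0 n _) x).trans ?_
      exact mul_le_of_le_one_right (hE0 x) (hφ1 n x)
  have hlim : Tendsto (fun n => K * (∑' x : {x // ¬ d x < ρ n}, E x * φ n x) ^ (1 / σ))
      atTop (𝓝 0) := by
    have := (hT.rpow_const (p := 1 / σ) (Or.inr (by positivity))).const_mul K
    rwa [Real.zero_rpow (by positivity), mul_zero] at this
  have hEx : E x ≤ 0 := by
    refine ge_of_tendsto hlim ?_
    filter_upwards [hφeq x] with n hn
    calc E x = E x * φ n x := by rw [hn, mul_one]
      _ ≤ S n := (hSsum n).le_tsum x fun y _ => hSφ0 n y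
      _ ≤ _ := hST n
  by_contra hne
  have := hm x; have := hp x; have := abs_pos.2 hne
  have : 0 < E x := by positivity
  linarith

end Discrete

/-! ### The path distance and the vertex problem -/

namespace MetricGraph

section Graph

variable {Vert Edge : Type*} {G : MetricGraph Vert Edge}

lemma pt_zero (e : Edge) : G.pt e 0 = Point.vertex (G.init e) := by simp [pt]

lemma pt_len (e : Edge) : G.pt e (G.len e) = Point.vertex (G.final e) := by
  simp [pt, G.len_pos e]

lemma PathOfLength.nonneg {x y : G.Point} {L : ℝ} (h : G.PathOfLength y x L) : 0 ≤ L := by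
  induction h with
  | nil => exact le_rfl
  | cons e s t hs ht h ih => exact add_nonneg ih (abs_nonneg _)

lemma dist_nonneg (x y : G.Point) : 0 ≤ G.dist x y :=
  Real.sInf_nonneg fun _ h => PathOfLength.nonneg h

lemma dist_pt_le {y : G.Point} {e : Edge} {s t : ℝ} (hs : s ∈ Icc 0 (G.len e))
    (ht : t ∈ Icc 0 (G.len e)) (hne : ∃ L, G.PathOfLength y (G.pt e s) L) :
    G.dist (G.pt e t) y ≤ G.dist (G.pt e s) y + |t - s| := by
  rw [← sub_le_iff_le_add]
  refine le_csInf hne fun L hL => sub_le_iff_le_add.2 ?_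
  exact csInf_le ⟨0, fun _ h => PathOfLength.nonneg h⟩ (PathOfLength.cons e s t hs ht hL)

lemma Adj.symm {x y : Vert} (h : G.Adj x y) : G.Adj y x :=
  let ⟨e, he⟩ := h
  ⟨e, he.symm⟩

lemma Connected.abs_dist_sub_le (hG : G.Connected) (hb : BddAbove (range G.len)) (x₀ : Vert)
    {x y : Vert} (h : G.Adj x y) :
    |G.dist (Point.vertex y) (Point.vertex x₀) - G.dist (Point.vertex x) (Point.vertex x₀)| ≤
      ⨆ e, G.len e := by
  obtain ⟨e, he⟩ := h
  have hl := G.len_pos e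
  have h0 : (0 : ℝ) ∈ Icc 0 (G.len e) := ⟨le_rfl, hl.le⟩
  have h1 : G.len e ∈ Icc 0 (G.len e) := ⟨hl.le, le_rfl⟩
  have a := dist_pt_le (y := Point.vertex x₀) h0 h1 (by rw [pt_zero]; exact hG _ _)
  have b := dist_pt_le (y := Point.vertex x₀) h1 h0 (by rw [pt_len]; exact hG _ _)
  rw [pt_zero, pt_len, sub_zero, abs_of_pos hl] at a
  rw [pt_zero, pt_len, zero_sub, abs_neg, abs_of_pos hl] at b
  have hle : G.len e ≤ ⨆ e, G.len e := le_ciSup hb e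
  rw [abs_le]
  rcases he with ⟨rfl, rfl⟩ | ⟨rfl, rfl⟩ <;> constructor <;> linarith

lemma LocallyFinite.finite_adj (hG : G.LocallyFinite) (x : Vert) : {y | G.Adj x y}.Finite := by
  refine (((hG x).image G.init).union ((hG x).image G.final)).subset ?_
  rintro y ⟨e, ⟨h1, h2⟩ | ⟨h1, h2⟩⟩
  · exact Or.inr ⟨e, Or.inl h1, h2⟩
  · exact Or.inl ⟨e, Or.inr h2, h1⟩

/-- On the vertices, `u` solves a discrete inequality to which `discrete_liouville` applies. -/
theorem eq_zero_on_vertices {W : G.VertexWeights} {x₀ : Vert} (hG : G.Standing W x₀)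
    {σ : ℝ} (hσ : 1 < σ) {P : G.Point → ℝ} (hP : ∀ x, 0 < P x) {δ C : ℝ} (hδ : 0 < δ)
    (hC : 0 < C) (hgrowth : G.WeightedGrowth W x₀ P σ δ C) {u : G.Point → ℝ}
    (hu : G.IsSolution W P σ u) {R₁ : ℝ} (hR₁ : G.R₀ ≤ R₁) (huX : G.MemX W x₀ (δ / R₁) u)
    (x : Vert) : u (Point.vertex x) = 0 := by
  obtain ⟨C₀, hC₀, hW⟩ := hG.weight_le
  set k : Vert → Vert → ℝ := fun x => {y | G.Adj x y}.indicator (W.ω x) with hk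
  have hk1 : ∀ x y, G.Adj x y → k x y = W.ω x y := fun x y h =>
    indicator_of_mem (s := {y | G.Adj x y}) h _
  have hk2 : ∀ x y, ¬ G.Adj x y → k x y = 0 := fun x y h =>
    indicator_of_notMem (s := {y | G.Adj x y}) h _
  have hkA : ∀ x y, k x y ≠ 0 → G.Adj x y := fun x y h => by
    by_contra h'
    exact h (hk2 x y h')
  have hfin : ∀ x, (Function.support (k x)).Finite := fun x =>
    (hG.locallyFinite.finite_adj x).subset fun y hy => hkA x y hy
  have hlap : ∀ x (f : Vert → ℝ),
      ∑' y, k x y * f y = ∑ᶠ y ∈ {y | G.Adj x y}, W.ω x y * f y := fun x f => by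
    rw [tsum_eq_finsum ((hfin x).subset fun y hy => left_ne_zero_of_mul hy), finsum_mem_def]
    exact finsum_congr fun y => (indicator_mul_left (s := {y | G.Adj x y}) (W.ω x) f).symm
  have hj : 0 ≤ ⨆ e, G.len e := Real.iSup_nonneg fun e => (G.len_pos e).le
  have hR₀ : (1 : ℝ) ≤ G.R₀ := le_max_right _ _
  have hμ := W.μ_pos
  refine discrete_liouville (k := k) (m := W.μ)
    (d := fun x => G.dist (Point.vertex x) (Point.vertex x₀))
    (u := fun x => u (Point.vertex x)) (p := fun x => P (Point.vertex x))
    (fun x y => ?_) (fun x y => ?_) hfin hC₀.le (fun x => ?_) W.μ_pos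
    (fun x => dist_nonneg _ _) hj
    (fun x y h => hG.connected.abs_dist_sub_le hG.len_bddAbove x₀ (hkA x y h)) (fun R => ?_) hσ
    (fun x => hP _) hδ hC.le (by linarith) (?_ : _ ≤ G.R₀) (fun R hR => ?_) (fun x => ?_) hR₁ ?_ x
  · by_cases h : G.Adj x y
    · rw [hk1 x y h]; exact (W.ω_pos x y h).le
    · rw [hk2 x y h]
  · by_cases h : G.Adj x y
    · rw [hk1 x y h, hk1 y x h.symm, W.ω_symm x y h]
    · rw [hk2 x y h, hk2 y x fun h' => h h'.symm]
  · have := hlap x fun _ => 1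
    simp only [mul_one] at this
    rw [this]
    exact hW x
  · exact ((hG.finite_ball (max R 1) (by positivity)).1).subset
      fun v (hv : _ < R) => lt_of_lt_of_le hv (le_max_left _ _)
  · exact le_trans (by linarith) (le_max_left _ _)
  · have hRpos : 0 < R := by linarith
    refine summable_and_tsum_le_of_ofReal (fun v => ?_) (by positivity) (hgrowth R hR).1
    have := hμ v.1
    have := hP (Point.vertex v.1)
    positivity
  · have h := hu.vertex_le x
    rw [vertexLaplacian, ← hlap x fun y => u (Point.vertex y) - u (Point.vertex x)] at h
    have h2 := mul_le_mul_of_nonneg_left h (hμ x).le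
    rw [mul_zero, mul_add, ← mul_assoc, mul_one_div_cancel (hμ x).ne', one_mul] at h2
    linarith
  · have h := (lt_of_le_of_lt le_self_add huX.2)
    rw [one_div_one, ENNReal.rpow_one] at h
    refine (ENNReal.summable_toReal h.ne).congr fun v => ?_
    have := hμ v
    rw [ENNReal.toReal_ofReal (by positivity), Real.rpow_one]
    ring

end Graph

end MetricGraph

/-! ### From the vertices to the edges -/

namespace MetricGraph

section Graph

variable {Vert Edge : Type*} {G : MetricGraph Vert Edge}

lemma concaveOn_onEdge {f : G.Point → ℝ} (hf : G.MemD f) {e : Edge}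
    (h : ∀ t ∈ Ioo 0 (G.len e), G.edgeLaplacian f e t ≤ 0) :
    ConcaveOn ℝ (Icc 0 (G.len e)) (G.onEdge f e) := by
  refine concaveOn_of_deriv2_nonpos (convex_Icc _ _) (hf.continuousOn e) ?_ ?_ ?_ <;>
    rw [interior_Icc]
  · exact (hf.contDiffOn_two e).differentiableOn (by norm_num)
  · exact ((hf.contDiffOn_two e).deriv_of_isOpen (m := 1) isOpen_Ioo
      (by norm_num)).differentiableOn (by norm_num)
  · exact h

/-- The chord of a concave function with equal values at both ends is horizontal, which gives the
signs of both one-sided derivatives. -/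
lemma outerNormalDeriv_nonpos {f : G.Point → ℝ} (hf : G.MemD f) {e : Edge}
    (hc : ConcaveOn ℝ (Icc 0 (G.len e)) (G.onEdge f e))
    (h : f (Point.vertex (G.init e)) = f (Point.vertex (G.final e))) (v : Vert) :
    G.outerNormalDeriv f e v ≤ 0 := by
  have hl := G.len_pos e
  have h0 : (0 : ℝ) ∈ Icc 0 (G.len e) := ⟨le_rfl, hl.le⟩
  have h1 : G.len e ∈ Icc 0 (G.len e) := ⟨hl.le, le_rfl⟩
  have hd := (hf.contDiffOn_one e).differentiableOn (by norm_num)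
  have hs : slope (G.onEdge f e) 0 (G.len e) = 0 := by
    rw [slope_def_field, onEdge, onEdge, pt_zero, pt_len, h, sub_self, zero_div]
  rw [outerNormalDeriv]
  split_ifs
  · exact (hc.derivWithin_le_slope h0 h1 hl (hd _ h1)).trans hs.le
  · exact neg_nonpos.2 (hs.ge.trans (hc.slope_le_derivWithin h0 h1 hl (hd _ h0)))

/-- A solution vanishing at the vertices is concave on the edges, so its outer normal derivatives
are nonpositive. They add up to zero at each vertex, hence all vanish, and a concave function which
is zero at both ends and has zero slope at one of them is zero. -/
theorem IsSolution.eq_zero_of_vertices {W : G.VertexWeights} {P : G.Point → ℝ} {σ : ℝ}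
    {u : G.Point → ℝ} (hu : G.IsSolution W P σ u) (hP : ∀ x, 0 < P x)
    (hfin : G.LocallyFinite) (hloop : ∀ e, G.init e ≠ G.final e)
    (hv : ∀ v, u (Point.vertex v) = 0) (x : G.Point) : u x = 0 := by
  cases x with
  | vertex v => exact hv v
  | inner e t ht =>
    have hc : ∀ e, ConcaveOn ℝ (Icc 0 (G.len e)) (G.onEdge u e) := fun e =>
      concaveOn_onEdge hu.memD fun t ht => by
        have h1 := hu.edge_le e t ht
        have h2 : 0 < G.onEdge P e t := hP _
        have h3 : 0 ≤ G.onEdge P e t * |G.onEdge u e t| ^ σ := by positivity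
        linarith
    have hn : ∀ e v, G.outerNormalDeriv u e v ≤ 0 := fun e v =>
      outerNormalDeriv_nonpos hu.memD (hc e) (by rw [hv, hv]) v
    have hD : derivWithin (G.onEdge u e) (Icc 0 (G.len e)) 0 = 0 := by
      have hk := hu.kirchhoff_eq (G.init e)
      rw [kirchhoff, finsum_mem_eq_finite_toFinset_sum _ (hfin (G.init e)),
        Finset.sum_eq_zero_iff_of_nonpos fun e _ => hn e _] at hk
      have := hk e ((Set.Finite.mem_toFinset _).2 (Or.inl rfl))
      rwa [outerNormalDeriv, if_neg (hloop e).symm, neg_eq_zero] at this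
    have hl := G.len_pos e
    have h0 : (0 : ℝ) ∈ Icc 0 (G.len e) := ⟨le_rfl, hl.le⟩
    have h1 : G.len e ∈ Icc 0 (G.len e) := ⟨hl.le, le_rfl⟩
    have e0 : G.onEdge u e 0 = 0 := by rw [onEdge, pt_zero, hv]
    have e1 : G.onEdge u e (G.len e) = 0 := by rw [onEdge, pt_len, hv]
    have hlow : 0 ≤ G.onEdge u e t := by
      have := (hc e).min_le_of_mem_Icc h0 h1 ⟨ht.1.le, ht.2.le⟩
      rwa [e0, e1, min_self] at this
    have hup : G.onEdge u e t ≤ 0 := by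
      have := (hc e).slope_le_derivWithin h0 ⟨ht.1.le, ht.2.le⟩ ht.1
        ((hu.memD.contDiffOn_one e).differentiableOn (by norm_num) _ h0)
      rw [hD, slope_def_field, e0, sub_zero, sub_zero, div_le_iff₀ ht.1, zero_mul] at this
      exact this
    have he : G.onEdge u e t = u (Point.inner e t ht) := by rw [onEdge, pt, dif_pos ht]
    rw [← he]
    exact le_antisymm hup hlow

end Graph

end MetricGraph

theorem theorem3p2 {Vert Edge : Type*} [Countable Vert] [Countable Edge]
    (G : MetricGraph Vert Edge) (W : G.VertexWeights) (x₀ : Vert) (hG : G.Standing W x₀)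
    (σ : ℝ) (hσ : 1 < σ)
    (P : G.Point → ℝ) (hP_pos : ∀ x, 0 < P x)
    (hP_meas : ∀ e, AEMeasurable (G.onEdge P e) (volume.restrict (Ioo 0 (G.len e))))
    (δ C : ℝ) (hδ : 0 < δ) (hC : 0 < C) (hP_growth : G.WeightedGrowth W x₀ P σ δ C)
    (u : G.Point → ℝ) (hu : G.IsSolution W P σ u)
    (R₁ : ℝ) (hR₁ : G.R₀ ≤ R₁) (huX : G.MemX W x₀ (δ / R₁) u) :
    ∀ x, u x = 0 :=
  hu.eq_zero_of_vertices hP_pos hG.locallyFinite hG.no_loops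
    (MetricGraph.eq_zero_on_vertices hG hσ hP_pos hδ hC hP_growth hu hR₁ huX)
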